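/- Let $\alpha\in(0,1)$ be irrational with continued fraction expansion $\alpha=[0;1+d_1,d_2,d_3,\ldots]$, where $d_i\ge 1$ for all $i\ge 1$. Let $c_\alpha$ be the characteristic Sturmian word of slope $\alpha$ over $\{a,b\}$, i.e. the infinite word whose letter at position $m\ge 0$ is $a$ if $\lfloor (m+2)\alpha\rfloor-\lfloor (m+1)\alpha\rfloor=0$ and $b$ otherwise. Define words $s_{-1}=b$, $s_0=a$, $s_n=s_{n-1}^{d_n}s_{n-2}$ for $n\ge 1$; let $w_n=as_nb^{-1}$ for odd $n\ge -1$ and $w_n=bs_na^{-1}$ for even $n\ge 0$ (so $w_{-1}=a$); let $v_{-2}=\varepsilon$ (the empty word), $v_n=as_{n+1}^{d_{n+2}-1}s_nb^{-1}$ for odd $n\ge -1$ and $v_n=bs_{n+1}^{d_{n+2}-1}s_na^{-1}$ for even $n\ge 0$. Here $xy^{-1}$, for a word $x$ ending in the letter $y$, is $x$ with that last letter removed. For integers $n\ge 0$ and $k\ge 0$ put $U_{n,k}=(w_{n-1}v_{n-2})^kw_{n-1}$ and $\overline U_{n,k}=(v_{n-2}w_{n-1})^kv_{n-2}$, and let $\widetilde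 v$ denote the reversal of a word $v$. Let $u$ be a palindrome over $\{a,b\}$ with $|u|\ge 2$. Then $u$ is a factor of $c_\alpha$ if and only if, for some integer $n\ge 0$, one of the following holds: (1) $u=vU_{n,k}\widetilde v$ for some suffix $v$ of $v_{n-2}$ with $v\ne v_{n-2}$ and some integer $k$ with $0\le k\le d_{n+1}-2$; or (2) $u=v\overline U_{n,k}\widetilde v$ for some suffix $v$ of $w_{n-1}$ with $v\ne w_{n-1}$ and some integer $k$ with $0\le k\le d_{n+1}-1$. (A proper suffix $v$ may be empty; in particular (1) never occurs for $n=0$ or when $d_{n+1}=1$.) -/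

import Mathlib

/-! Words over `{a, b}`, characteristic Sturmian words, standard sequences and singular words. -/

namespace Sturmian

/-- The two-letter alphabet. -/
inductive Letter : Type
  | a : Letter
  | b : Letter

/-- Finite words; concatenation is `++`, reversal is `List.reverse`, suffix is `<:+`. -/
abbrev Word : Type := List Letter

/-- Infinite words `x = x_0 x_1 x_2 ⋯`. -/
abbrev InfWord : Type := ℕ → Letter

/-- The power `w^k`. -/
def wpow (w : Word) (k : ℕ) : Word := (List.replicate k w).flatten

/-- `u` is a factor of the infinite word `x`: it occurs in `x` at some position `i`. -/
def IsFactor (u : Word) (x : InfWord) : Prop :=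
  ∃ i : ℕ, ∀ (j : ℕ) (hj : j < u.length), u[j] = x (i + j)

open Classical in
/-- The Sturmian word `s_{α,ρ}` of slope `α` and intercept `ρ`. -/
noncomputable def sturmianWord (α ρ : ℝ) : InfWord := fun n =>
  if ⌊((n : ℝ) + 1) * α + ρ⌋ - ⌊(n : ℝ) * α + ρ⌋ = 0 then Letter.a else Letter.b

/-- The characteristic Sturmian word `c_α`, given by `s_{α,0} = a c_α`. -/
noncomputable def charWord (α : ℝ) : InfWord := fun n => sturmianWord α 0 (n + 1)

/-- For `0 < α < 1`, the first letter of `s_{α,0}` is `a`, so that indeed `s_{α,0} = a c_α`. -/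
theorem sturmianWord_zero (α : ℝ) (h0 : 0 < α) (h1 : α < 1) :
    sturmianWord α 0 0 = Letter.a := by
  have h : ⌊α⌋ = 0 := Int.floor_eq_zero_iff.mpr ⟨h0.le, h1⟩
  simp [sturmianWord, h]

/-- `α = [0; a_1, a_2, a_3, …]` (infinite simple continued fraction; `a 0` is not used). -/
def HasContFract (α : ℝ) (a : ℕ → ℕ) : Prop :=
  (GenContFract.of α).h = 0 ∧
    ∀ i : ℕ, (GenContFract.of α).s.get? i = some ⟨1, (a (i + 1) : ℝ)⟩

/-- `α = [0; 1 + d_1, d_2, d_3, …]` with all `d_i ≥ 1` (`d 0` is not used). -/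
def IsDirective (α : ℝ) (d : ℕ → ℕ) : Prop :=
  (∀ i : ℕ, 1 ≤ i → 1 ≤ d i) ∧ HasContFract α (fun i => if i = 1 then 1 + d 1 else d i)

/-- The standard sequence, with indices shifted by one: `stdWord d n` is `s_{n-1}`, where
`s_{-1} = b`, `s_0 = a` and `s_n = s_{n-1}^{d_n} s_{n-2}` for `n ≥ 1`. -/
def stdWord (d : ℕ → ℕ) : ℕ → Word
  | 0 => [Letter.b]
  | 1 => [Letter.a]
  | n + 2 => wpow (stdWord d (n + 1)) (d (n + 1)) ++ stdWord d n

/-- The singular words, with indices shifted by one: `singWord d n` is `w_{n-1}`, where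
`w_m = a s_m b⁻¹` for odd `m` (in particular `w_{-1} = a`) and `w_m = b s_m a⁻¹` for even `m`.
The cancelled letter is the last letter of `s_m`, see `stdWord_eq`. -/
def singWord (d : ℕ → ℕ) (n : ℕ) : Word :=
  if Even n then Letter.a :: (stdWord d n).dropLast else Letter.b :: (stdWord d n).dropLast

/-- The adjoining singular words, with indices shifted by two: `adjWord d n` is `v_{n-2}`, where
`v_{-2} = ε` and, for `m ≥ -1`, `v_m = a s_{m+1}^{d_{m+2}-1} s_m b⁻¹` for odd `m` and
`v_m = b s_{m+1}^{d_{m+2}-1} s_m a⁻¹` for even `m`. -/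
def adjWord (d : ℕ → ℕ) : ℕ → Word
  | 0 => []
  | n + 1 =>
    if Even n then
      Letter.a :: (wpow (stdWord d (n + 1)) (d (n + 1) - 1) ++ stdWord d n).dropLast
    else
      Letter.b :: (wpow (stdWord d (n + 1)) (d (n + 1) - 1) ++ stdWord d n).dropLast

/-- `U_{n,k} = (w_{n-1} v_{n-2})^k w_{n-1}`. -/
def U (d : ℕ → ℕ) (n k : ℕ) : Word := wpow (singWord d n ++ adjWord d n) k ++ singWord d n

/-- `Ū_{n,k} = (v_{n-2} w_{n-1})^k v_{n-2}`. -/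
def Ubar (d : ℕ → ℕ) (n k : ℕ) : Word := wpow (adjWord d n ++ singWord d n) k ++ adjWord d n

/-- `v` is a proper suffix of `w` (possibly empty). -/
def IsProperSuffix (v w : Word) : Prop := v <:+ w ∧ v ≠ w

/-- `s_{n-1}` ends in `b` for even `n` and in `a` for odd `n`. -/
theorem stdWord_eq (d : ℕ → ℕ) (n : ℕ) :
    stdWord d n = (stdWord d n).dropLast ++ [if Even n then Letter.b else Letter.a] := by
  induction n using Nat.twoStepInduction with
  | zero => simp [stdWord]
  | one => simp [stdWord]
  | more n ih _ =>
    have he : Even (n + 2) ↔ Even n := by simp [Nat.even_add]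
    simp only [he, stdWord]
    rw [ih, ← List.append_assoc, List.dropLast_concat]

end Sturmian

namespace Sturmian

/-! Two factors of equal length have at most one `b` of difference, so `apa` and `bpb` are never
both factors. Hence symmetric extensions of a fixed centre `p` that are factors form a chain
(`suffix_or_suffix_of_isFactor`).

The words `U` and `Ubar` are links of these chains: `U_succ` and `Ubar_succ` wrap each in the
other's building block, and the last two `U` of level n are v_{n-1} and w_{n+1}. They are factors
because every s_n with n ≥ 0 is a prefix of c_α, which comes from best approximation (`abs_err_le`,
`occAt_stdWord`).

A palindrome has centre ε, `a` or `b`, that is v_{-2}, w_{-1} or w_0. Compared with the next link of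
its chain, it either falls strictly short, and is then listed, or contains that link as a new
centre. Centres get longer with the level, so the climb ends. -/

/-! ### Occurrences of finite words in infinite words -/

/-- `u` occurs in `x` at position `i`. -/
def OccAt (x : InfWord) : Word → ℕ → Prop
  | [], _ => True
  | y :: u, i => y = x i ∧ OccAt x u (i + 1)

theorem occAt_iff (x : InfWord) (u : Word) (i : ℕ) :
    OccAt x u i ↔ ∀ (j : ℕ) (hj : j < u.length), u[j] = x (i + j) := by
  induction u generalizing i with
  | nil => simp [OccAt]
  | cons y u ih =>
    simp only [OccAt, ih]
    constructor
    · rintro ⟨h, h'⟩ j hj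
      cases j with
      | zero => simpa using h
      | succ j =>
        have := h' j (by simpa using hj)
        simp only [List.getElem_cons_succ, this]
        congr 1
        omega
    · intro h
      refine ⟨h 0 (by simp), fun j hj => ?_⟩
      have := h (j + 1) (by simpa using hj)
      simp only [List.getElem_cons_succ] at this
      rw [this]
      congr 1
      omega

theorem isFactor_iff (x : InfWord) (u : Word) : IsFactor u x ↔ ∃ i, OccAt x u i := by
  simp only [IsFactor, occAt_iff]

theorem occAt_append (x : InfWord) (u v : Word) (i : ℕ) :
    OccAt x (u ++ v) i ↔ OccAt x u i ∧ OccAt x v (i + u.length) := by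
  induction u generalizing i with
  | nil => simp [OccAt]
  | cons y u ih =>
    simp only [List.cons_append, OccAt, ih, List.length_cons, and_assoc]
    rw [show i + 1 + u.length = i + (u.length + 1) by omega]

theorem OccAt.shift {x : InfWord} {u : Word} {i : ℕ} (L : ℕ) (h : OccAt x u i)
    (hp : ∀ m, i ≤ m → m < i + u.length → x (m + L) = x m) : OccAt x u (i + L) := by
  rw [occAt_iff] at h ⊢
  intro j hj
  rw [h j hj, ← hp (i + j) (by omega) (by omega)]
  congr 1
  omega

theorem IsFactor.of_infix {x : InfWord} {u v : Word} (h : IsFactor v x) (huv : u <:+: v) :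
    IsFactor u x := by
  obtain ⟨s, t, rfl⟩ := huv
  rw [isFactor_iff] at h ⊢
  obtain ⟨i, h⟩ := h
  rw [occAt_append, occAt_append] at h
  exact ⟨_, h.1.2⟩

/-! ### Balance -/

/-- The indicator of the letter `b`. -/
def weight : Letter → ℤ
  | Letter.a => 0
  | Letter.b => 1

/-- The number of occurrences of `b` in a word. -/
def height (u : Word) : ℤ := (u.map weight).sum

@[simp] theorem height_append (u v : Word) : height (u ++ v) = height u + height v := by
  simp [height]

theorem floor_succ_mul (α : ℝ) (h0 : 0 < α) (h1 : α < 1) (x : ℝ) :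
    ⌊x + α⌋ = ⌊x⌋ ∨ ⌊x + α⌋ = ⌊x⌋ + 1 := by
  have h2 : ⌊x⌋ ≤ ⌊x + α⌋ := Int.floor_mono (by linarith)
  have h3 : ⌊x + α⌋ < ⌊x⌋ + 2 := by
    rw [Int.floor_lt]
    push_cast
    linarith [Int.lt_floor_add_one x]
  omega

theorem weight_charWord {α : ℝ} (h0 : 0 < α) (h1 : α < 1) (m : ℕ) :
    weight (charWord α m) = ⌊((m : ℝ) + 2) * α⌋ - ⌊((m : ℝ) + 1) * α⌋ := by
  have h := floor_succ_mul α h0 h1 (((m : ℝ) + 1) * α)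
  rw [show ((m : ℝ) + 1) * α + α = ((m : ℝ) + 2) * α by ring] at h
  simp only [charWord, sturmianWord]
  push_cast
  rw [show ((m : ℝ) + 1 + 1) * α + 0 = ((m : ℝ) + 2) * α by ring,
    show ((m : ℝ) + 1) * α + 0 = ((m : ℝ) + 1) * α by ring]
  split_ifs with hc
  · rw [hc]; rfl
  · have : ⌊((m : ℝ) + 2) * α⌋ - ⌊((m : ℝ) + 1) * α⌋ = 1 := by omega
    rw [this]; rfl

theorem weight_injective : Function.Injective weight := by
  intro x y h
  cases x <;> cases y <;> simp_all [weight]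

theorem height_of_occAt {α : ℝ} (h0 : 0 < α) (h1 : α < 1) {u : Word} {i : ℕ}
    (h : OccAt (charWord α) u i) :
    height u = ⌊((i : ℝ) + 1 + u.length) * α⌋ - ⌊((i : ℝ) + 1) * α⌋ := by
  induction u generalizing i with
  | nil => simp [height]
  | cons y u ih =>
    obtain ⟨hy, hu⟩ := h
    have h2 := ih hu
    have h3 := weight_charWord h0 h1 i
    have h4 : height (y :: u) = weight y + height u := by simp [height]
    rw [h4, hy, h3, h2, List.length_cons]
    push_cast
    rw [show (i : ℝ) + 1 + 1 + u.length = i + 1 + (u.length + 1) by ring,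
      show (i : ℝ) + 1 + 1 = i + 2 by ring]
    ring

/-- With y = |v|α, each height has the form ⌊x + y⌋ - ⌊x⌋, which is ⌊y⌋ or ⌊y⌋ + 1. -/
theorem height_le_of_isFactor {α : ℝ} (h0 : 0 < α) (h1 : α < 1) {u v : Word}
    (hu : IsFactor u (charWord α)) (hv : IsFactor v (charWord α)) (hl : u.length = v.length) :
    height u ≤ height v + 1 := by
  rw [isFactor_iff] at hu hv
  obtain ⟨i, hi⟩ := hu
  obtain ⟨j, hj⟩ := hv
  rw [height_of_occAt h0 h1 hi, height_of_occAt h0 h1 hj, hl, add_mul, add_mul _ (v.length : ℝ)]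
  set y := (v.length : ℝ) * α
  have h2 := Int.le_floor_add ((j + 1 : ℝ) * α) y
  have h3 := Int.le_floor_add_floor ((i + 1 : ℝ) * α) y
  omega

theorem eq_of_isFactor_surround {α : ℝ} (h0 : 0 < α) (h1 : α < 1) {p : Word} {x y : Letter}
    (hx : IsFactor (x :: p ++ [x]) (charWord α)) (hy : IsFactor (y :: p ++ [y]) (charWord α)) :
    x = y := by
  have h2 := height_le_of_isFactor h0 h1 hx hy (by simp)
  have h3 := height_le_of_isFactor h0 h1 hy hx (by simp)
  cases x <;> cases y <;> simp [height, weight] at h2 h3 ⊢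

/-- Balance forces the letters next to `p` to agree; the induction absorbs them into the centre. -/
theorem prefix_or_prefix_of_isFactor {α : ℝ} (h0 : 0 < α) (h1 : α < 1) {p r s : Word}
    (hr : IsFactor (r.reverse ++ p ++ r) (charWord α))
    (hs : IsFactor (s.reverse ++ p ++ s) (charWord α)) : r <+: s ∨ s <+: r := by
  induction r generalizing p s with
  | nil => exact Or.inl List.nil_prefix
  | cons x r ih =>
    cases s with
    | nil => exact Or.inr List.nil_prefix
    | cons y s =>
      have hxy : x = y := by
        refine eq_of_isFactor_surround h0 h1 (p := p) (hr.of_infix ⟨r.reverse, r, ?_⟩)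
          (hs.of_infix ⟨s.reverse, s, ?_⟩) <;> simp
      subst hxy
      simp only [List.prefix_cons_inj]
      exact ih (p := x :: p ++ [x]) (by simpa using hr) (by simpa using hs)

theorem suffix_or_suffix_of_isFactor {α : ℝ} (h0 : 0 < α) (h1 : α < 1) {p v w : Word}
    (hv : IsFactor (v ++ p ++ v.reverse) (charWord α))
    (hw : IsFactor (w ++ p ++ w.reverse) (charWord α)) : v <:+ w ∨ w <:+ v := by
  rw [← List.reverse_prefix, ← List.reverse_prefix (l₁ := w)]
  exact prefix_or_prefix_of_isFactor h0 h1 (by simpa using hv) (by simpa using hw)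

/-! ### Powers -/

@[simp] theorem wpow_zero (w : Word) : wpow w 0 = [] := rfl

theorem wpow_succ (w : Word) (k : ℕ) : wpow w (k + 1) = w ++ wpow w k := by
  simp [wpow, List.replicate_succ]

theorem wpow_succ' (w : Word) (k : ℕ) : wpow w (k + 1) = wpow w k ++ w := by
  simp [wpow, List.replicate_succ']

theorem wpow_append_comm (u v : Word) (k : ℕ) : wpow (u ++ v) k ++ u = u ++ wpow (v ++ u) k := by
  induction k with
  | zero => simp
  | succ k ih => rw [wpow_succ, wpow_succ, List.append_assoc, ih]; simp

theorem reverse_wpow (w : Word) (k : ℕ) : (wpow w k).reverse = wpow w.reverse k := by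
  induction k with
  | zero => simp
  | succ k ih => rw [wpow_succ, wpow_succ', List.reverse_append, ih]

/-! ### Diophantine properties of the standard words -/

theorem height_wpow (w : Word) (k : ℕ) : height (wpow w k) = k * height w := by
  induction k with
  | zero => simp [height]
  | succ k ih => rw [wpow_succ, height_append, ih]; push_cast; ring

theorem length_wpow (w : Word) (k : ℕ) : (wpow w k).length = k * w.length := by
  simp [wpow]

theorem length_stdWord (d : ℕ → ℕ) (n : ℕ) : (stdWord d (n + 2)).length =
    d (n + 1) * (stdWord d (n + 1)).length + (stdWord d n).length := by
  simp [stdWord, length_wpow]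

theorem height_stdWord (d : ℕ → ℕ) (n : ℕ) : height (stdWord d (n + 2)) =
    d (n + 1) * height (stdWord d (n + 1)) + height (stdWord d n) := by
  simp [stdWord, height_wpow]

theorem length_stdWord_pos (d : ℕ → ℕ) (n : ℕ) : 0 < (stdWord d n).length := by
  rw [stdWord_eq]
  simp

theorem le_length_stdWord {d : ℕ → ℕ} (hd : ∀ i, 1 ≤ i → 1 ≤ d i) (n : ℕ) :
    n ≤ (stdWord d n).length := by
  induction n using Nat.twoStepInduction with
  | zero => simp
  | one => simp [stdWord]
  | more n _ ih =>
    have h1 := length_stdWord d n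
    have h2 := length_stdWord_pos d n
    have h3 := Nat.le_mul_of_pos_left (stdWord d (n + 1)).length (hd (n + 1) (by omega))
    omega

theorem det_stdWord (d : ℕ → ℕ) (n : ℕ) :
    ((stdWord d n).length * height (stdWord d (n + 1)) -
      (stdWord d (n + 1)).length * height (stdWord d n)) ^ 2 = 1 := by
  induction n with
  | zero => simp [stdWord, height, weight]
  | succ n ih =>
    rw [length_stdWord, height_stdWord, ← ih]
    push_cast
    ring

/-- The signed error `|s| α - |s|_b` of the `n`-th standard word. -/
noncomputable def err (α : ℝ) (d : ℕ → ℕ) (n : ℕ) : ℝ :=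
  (stdWord d n).length * α - height (stdWord d n)

/-- The `t i` are the continued fraction tails. Since the first partial quotient is 1 + d_1, using
1/α - 1 in place of 1/α makes the recursion uniform, whence t_0 = α/(1-α). -/
theorem IsDirective.exists_tails {α : ℝ} (h0 : 0 < α) (h1 : α < 1) {d : ℕ → ℕ}
    (hd : IsDirective α d) : ∃ t : ℕ → ℝ, t 0 * (1 - α) = α ∧
      ∀ i, 0 < t i ∧ t i < 1 ∧ t i * (d (i + 1) + t (i + 1)) = 1 := by
  obtain ⟨hd1, -, hs⟩ := hd
  have key : ∀ i, ∃ p : GenContFract.IntFractPair ℝ,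
      GenContFract.IntFractPair.stream α i = some p := by
    intro i
    cases i with
    | zero => exact ⟨_, GenContFract.IntFractPair.stream_zero α⟩
    | succ i =>
      obtain ⟨p, hp, -⟩ :=
        GenContFract.IntFractPair.exists_succ_get?_stream_of_gcf_of_get?_eq_some (hs i)
      exact ⟨p, hp⟩
  choose g hg using key
  have hrec : ∀ i, 0 < (g i).fr ∧ (g i).fr < 1 ∧
      (g i).fr * ((if i + 1 = 1 then 1 + d 1 else d (i + 1) : ℕ) + (g (i + 1)).fr) = 1 := by
    intro i
    obtain ⟨p, hp, hpb⟩ :=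
      GenContFract.IntFractPair.exists_succ_get?_stream_of_gcf_of_get?_eq_some (hs i)
    obtain rfl : g (i + 1) = p := Option.some.inj ((hg (i + 1)).symm.trans hp)
    obtain ⟨q, hq, hq0, hqp⟩ :=
      GenContFract.IntFractPair.succ_nth_stream_eq_some_iff.1 hp
    obtain rfl : g i = q := Option.some.inj ((hg i).symm.trans hq)
    have hnn := GenContFract.IntFractPair.nth_stream_fr_nonneg hq
    refine ⟨lt_of_le_of_ne hnn (Ne.symm hq0), GenContFract.IntFractPair.nth_stream_fr_lt_one hq, ?_⟩
    have hfr : (g (i + 1)).fr = (g i).fr⁻¹ - ((g (i + 1)).b : ℝ) := by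
      rw [← hqp]; rfl
    simp only at hpb
    rw [hfr, hpb]
    field_simp
    ring
  have hg0 : (g 0).fr = α := by
    have := (hg 0).symm.trans (GenContFract.IntFractPair.stream_zero α)
    rw [Option.some.inj this]
    exact Int.fract_eq_self.2 ⟨h0.le, h1⟩
  refine ⟨fun i => if i = 0 then α / (1 - α) else (g i).fr, ?_, fun i => ?_⟩
  · have : 1 - α ≠ 0 := by linarith
    simp only [if_true]
    field_simp
  · rcases Nat.eq_zero_or_pos i with rfl | hi
    · obtain ⟨-, -, h⟩ := hrec 0
      have h2 := (hrec 1).1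
      have hd' : (1 : ℝ) ≤ d 1 := by exact_mod_cast hd1 1 le_rfl
      have h3 : 0 < 1 - α := by linarith
      simp only [zero_add, if_true, one_ne_zero, if_false, hg0] at h ⊢
      push_cast at h
      refine ⟨by positivity, ?_, ?_⟩
      · rw [div_lt_one h3]
        nlinarith
      · rw [div_mul_eq_mul_div, div_eq_one_iff_eq h3.ne']
        linarith
    · have h := hrec i
      have h2 : i + 1 ≠ 1 := by omega
      have h3 : i ≠ 0 := by omega
      simpa [h2, h3] using h

theorem err_rec (α : ℝ) (d : ℕ → ℕ) (n : ℕ) :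
    err α d (n + 2) = d (n + 1) * err α d (n + 1) + err α d n := by
  simp only [err, length_stdWord, height_stdWord]
  push_cast
  ring

/-- Successive errors alternate in sign and shrink, with the tails as ratios. -/
theorem IsDirective.err_succ {α : ℝ} (h0 : 0 < α) (h1 : α < 1) {d : ℕ → ℕ}
    (hd : IsDirective α d) : ∃ t : ℕ → ℝ, ∀ n, 0 < t n ∧ t n < 1 ∧
      err α d (n + 1) = - t n * err α d n := by
  obtain ⟨t, ht0, ht⟩ := hd.exists_tails h0 h1
  refine ⟨t, fun n => ⟨(ht n).1, (ht n).2.1, ?_⟩⟩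
  induction n with
  | zero => simp [err, stdWord, height, weight]; linarith
  | succ n ih =>
    rw [err_rec]
    have h := (ht n).2.2
    have : err α d n = -(d (n + 1) + t (n + 1)) * err α d (n + 1) := by
      rw [ih]
      linear_combination - err α d n * h
    rw [this]
    ring

/-- The best approximation property of the standard words. -/
theorem abs_err_le {α : ℝ} (h0 : 0 < α) (h1 : α < 1) {d : ℕ → ℕ}
    (hd : IsDirective α d) (n : ℕ) {j : ℤ} (hj : 1 ≤ j)
    (hjn : j < (stdWord d (n + 1)).length) (m : ℤ) : |err α d n| ≤ |j * α - m| := by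
  obtain ⟨t, ht⟩ := hd.err_succ h0 h1
  obtain ⟨htp, -, hte⟩ := ht n
  set q : ℤ := ((stdWord d n).length : ℤ) with hq
  set q' : ℤ := ((stdWord d (n + 1)).length : ℤ) with hq'
  set p := height (stdWord d n) with hp
  set p' := height (stdWord d (n + 1)) with hp'
  have hqpos : 0 < q := Int.natCast_pos.2 <| length_stdWord_pos d n
  have hqpos' : 0 < q' := Int.natCast_pos.2 <| length_stdWord_pos d (n + 1)
  have hdet : (q * p' - q' * p) ^ 2 = 1 := det_stdWord d n
  obtain ⟨x, y, hxj, hxm⟩ : ∃ x y : ℤ, j = x * q + y * q' ∧ m = x * p + y * p' := by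
    -- Cramer's rule: the determinant is ±1, hence its own inverse.
    refine ⟨(q * p' - q' * p) * (j * p' - m * q'), (q * p' - q' * p) * (m * q - j * p), ?_, ?_⟩
    · linear_combination - j * hdet
    · linear_combination - m * hdet
  have hval : (j : ℝ) * α - m = (x - y * t n) * err α d n := by
    have e1 : err α d n = q * α - p := by simp [err, hq, hp]
    have e2 : err α d (n + 1) = q' * α - p' := by simp [err, hq', hp']
    rw [sub_mul, mul_assoc, show t n * err α d n = - err α d (n + 1) by rw [hte]; ring, e1, e2,
      hxj, hxm]
    push_cast
    ring
  rw [hval, abs_mul]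
  refine le_mul_of_one_le_left (abs_nonneg _) ?_
  -- Since 0 < j < q', x is nonzero and y does not share its sign, so x and -y t_n do not cancel.
  rcases lt_trichotomy x 0 with hx | hx | hx
  · have hy : 0 ≤ y := by
      by_contra hy
      nlinarith
    have hx' : (x : ℝ) ≤ -1 := by exact_mod_cast (by omega : x ≤ -1)
    have hy' : (0 : ℝ) ≤ y := by exact_mod_cast hy
    rw [le_abs]
    right
    nlinarith
  · subst hx
    exfalso
    rcases le_or_gt y 0 with hy | hy <;> nlinarith
  · have hy : y ≤ 0 := by
      by_contra hy
      nlinarith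
    have hx' : (1 : ℝ) ≤ x := by exact_mod_cast hx
    have hy' : (y : ℝ) ≤ 0 := by exact_mod_cast hy
    rw [le_abs]
    left
    nlinarith

/-- Adding the error to jα cannot carry it past a neighbouring integer, by `abs_err_le`.
Irrationality keeps it from landing on the upper one. -/
theorem floor_add_length {α : ℝ} (hirr : Irrational α) (h0 : 0 < α) (h1 : α < 1) {d : ℕ → ℕ}
    (hd : IsDirective α d) (n : ℕ) {j : ℕ} (hj : 1 ≤ j)
    (hjn : j < (stdWord d (n + 1)).length) :
    ⌊((j : ℝ) + (stdWord d n).length) * α⌋ = ⌊(j : ℝ) * α⌋ + height (stdWord d n) := by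
  have hb := fun m => abs_err_le h0 h1 hd n (j := j) (by exact_mod_cast hj)
    (by exact_mod_cast hjn) m
  have hirr' := (hirr.natCast_mul (m := j + (stdWord d n).length) (by omega)).ne_int
    (⌊(j : ℝ) * α⌋ + height (stdWord d n) + 1)
  have hlo := hb ⌊(j : ℝ) * α⌋
  have hhi := hb (⌊(j : ℝ) * α⌋ + 1)
  have hf1 := Int.floor_le ((j : ℝ) * α)
  have hf2 := Int.lt_floor_add_one ((j : ℝ) * α)
  push_cast at hlo hhi hirr'
  rw [abs_of_nonneg (sub_nonneg.2 hf1)] at hlo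
  rw [abs_of_nonpos (sub_nonpos.2 hf2.le)] at hhi
  have he : err α d n = (stdWord d n).length * α - height (stdWord d n) := rfl
  have h2 := le_abs_self (err α d n)
  have h3 := neg_abs_le (err α d n)
  rw [Int.floor_eq_iff]
  push_cast
  refine ⟨by linarith, lt_of_le_of_ne (by linarith) hirr'⟩

theorem charWord_add_length {α : ℝ} (hirr : Irrational α) (h0 : 0 < α) (h1 : α < 1) {d : ℕ → ℕ}
    (hd : IsDirective α d) (n : ℕ) {m : ℕ} (hm : m + 2 < (stdWord d (n + 1)).length) :
    charWord α (m + (stdWord d n).length) = charWord α m := by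
  apply weight_injective
  rw [weight_charWord h0 h1, weight_charWord h0 h1]
  have e1 := floor_add_length hirr h0 h1 hd n (j := m + 1) (by omega) (by omega)
  have e2 := floor_add_length hirr h0 h1 hd n (j := m + 2) (by omega) hm
  push_cast at e1 e2 ⊢
  rw [show (m : ℝ) + (stdWord d n).length + 2 = m + 2 + (stdWord d n).length by ring,
    show (m : ℝ) + (stdWord d n).length + 1 = m + 1 + (stdWord d n).length by ring, e1, e2]
  ring

/-! ### Standard words as prefixes of c_α. -/

theorem occAt_wpow_a (x : InfWord) (k i : ℕ) (h : ∀ m, i ≤ m → m < i + k → x m = Letter.a) :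
    OccAt x (wpow [Letter.a] k) i := by
  induction k generalizing i with
  | zero => trivial
  | succ k ih =>
    rw [wpow_succ]
    exact ⟨(h i le_rfl (by omega)).symm, ih (i + 1) fun m h2 h3 => h m (by omega) (by omega)⟩

theorem occAt_stdWord {α : ℝ} (hirr : Irrational α) (h0 : 0 < α) (h1 : α < 1) {d : ℕ → ℕ}
    (hd : IsDirective α d) (n : ℕ) : OccAt (charWord α) (stdWord d (n + 1)) 0 := by
  have hd1 := hd.1 1 le_rfl
  obtain ⟨t, ht⟩ := hd.err_succ h0 h1
  obtain ⟨-, -, e0⟩ := ht 0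
  obtain ⟨t1p, t1l, e1⟩ := ht 1
  have herr : err α d 2 = (d 1 + 1) * α - 1 := by
    rw [err_rec]
    simp [err, stdWord, height, weight]
    ring
  have herr1 : err α d 1 = α := by simp [err, stdWord, height, weight]
  rw [herr, herr1] at e1
  -- These two bounds say that c_α starts with a^{d_1} b.
  have hlt : ((d 1 : ℝ) + 1) * α < 1 := by nlinarith
  have hgt : 1 < ((d 1 : ℝ) + 2) * α := by nlinarith
  have hzero : ∀ j : ℕ, j ≤ d 1 + 1 → ⌊(j : ℝ) * α⌋ = 0 := by
    intro j hj
    have : (j : ℝ) ≤ d 1 + 1 := by exact_mod_cast hj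
    rw [Int.floor_eq_zero_iff]
    exact ⟨by positivity, by nlinarith⟩
  have hone : ⌊((d 1 : ℝ) + 2) * α⌋ = 1 := by
    rw [Int.floor_eq_iff]
    push_cast
    exact ⟨hgt.le, by nlinarith⟩
  have ha : ∀ m, m < d 1 → charWord α m = Letter.a := by
    intro m hm
    apply weight_injective
    have z1 := hzero (m + 1) (by omega)
    have z2 := hzero (m + 2) (by omega)
    push_cast at z1 z2
    rw [weight_charWord h0 h1, z1, z2]
    rfl
  have hb : charWord α (d 1) = Letter.b := by
    apply weight_injective
    have z1 := hzero (d 1 + 1) le_rfl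
    push_cast at z1
    rw [weight_charWord h0 h1, z1, hone]
    rfl
  induction n using Nat.twoStepInduction with
  | zero => exact ⟨(ha 0 (by omega)).symm, trivial⟩
  | one =>
    simp only [stdWord]
    rw [occAt_append]
    refine ⟨occAt_wpow_a _ _ _ fun m _ hm => ha m (by simpa using hm), ?_, trivial⟩
    simp [length_wpow, hb]
  | more n ih1 ih2 =>
    -- Near-periodicity of c_α adds one power at a time. The two letters where it may fail are
    -- covered by `stdWord d (n + 2)` having length at least 2.
    have key : ∀ k, k ≤ d (n + 2) →
        OccAt (charWord α) (wpow (stdWord d (n + 2)) k ++ stdWord d (n + 1)) 0 := by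
      intro k
      induction k with
      | zero => intro _; simpa using ih1
      | succ k ih =>
        intro hk
        rw [wpow_succ, List.append_assoc, occAt_append]
        refine ⟨ih2, (ih (by omega)).shift _ fun m _ hm => ?_⟩
        apply charWord_add_length hirr h0 h1 hd (n + 2)
        have l1 := length_stdWord d (n + 1)
        have l2 := le_length_stdWord hd.1 (n + 2)
        have l3 : (k + 1) * (stdWord d (n + 2)).length ≤
          d (n + 2) * (stdWord d (n + 2)).length := Nat.mul_le_mul_right _ hk
        rw [add_mul, one_mul] at l3
        simp only [List.length_append, length_wpow] at hm
        show m + 2 < (stdWord d (n + 1 + 2)).length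
        rw [l1]
        show m + 2 < d (n + 2) * (stdWord d (n + 2)).length + _
        omega
    exact key _ le_rfl

/-! ### Singular words -/

/-- The first letter of `w_{n-1}`. -/
def headLetter (n : ℕ) : Letter := if Even n then Letter.a else Letter.b

theorem singWord_eq (d : ℕ → ℕ) (n : ℕ) :
    singWord d n = headLetter n :: (stdWord d n).dropLast := by
  unfold singWord headLetter
  split_ifs <;> rfl

theorem adjWord_succ (d : ℕ → ℕ) (n : ℕ) : adjWord d (n + 1) =
    headLetter n :: (wpow (stdWord d (n + 1)) (d (n + 1) - 1) ++ stdWord d n).dropLast := by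
  unfold headLetter
  simp only [adjWord]
  split_ifs <;> rfl

theorem stdWord_ne_nil (d : ℕ → ℕ) (n : ℕ) : stdWord d n ≠ [] :=
  List.ne_nil_of_length_pos (length_stdWord_pos d n)

theorem headLetter_add_two (n : ℕ) : headLetter (n + 2) = headLetter n := by
  simp [headLetter, Nat.even_add]

theorem stdWord_succ_eq (d : ℕ → ℕ) (n : ℕ) :
    stdWord d (n + 1) = (stdWord d (n + 1)).dropLast ++ [headLetter n] := by
  conv_lhs => rw [stdWord_eq]
  congr 2
  simp only [headLetter, Nat.even_add_one]
  split_ifs <;> rfl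

/-- `headLetter n` is the last letter of `stdWord d (n + 1)`, so this is a cyclic shift of that
word, and the same shift passes to its powers in `U_eq`. -/
theorem singWord_append_adjWord {d : ℕ → ℕ} (hd : ∀ i, 1 ≤ i → 1 ≤ d i) (n : ℕ) :
    singWord d n ++ adjWord d n = headLetter n :: (stdWord d (n + 1)).dropLast := by
  cases n with
  | zero => simp [singWord, adjWord, stdWord, headLetter]
  | succ n =>
    rw [singWord_eq, adjWord_succ]
    have h : stdWord d (n + 1) ++ wpow (stdWord d (n + 1)) (d (n + 1) - 1) =
        wpow (stdWord d (n + 1)) (d (n + 1)) := by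
      rw [← wpow_succ, Nat.sub_add_cancel (hd _ (by omega))]
    have h2 := stdWord_succ_eq d n
    simp only [stdWord]
    rw [← h, List.dropLast_append_of_ne_nil (stdWord_ne_nil d n),
      List.dropLast_append_of_ne_nil (stdWord_ne_nil d n)]
    conv_rhs => rw [List.append_assoc]; arg 2; arg 1; rw [h2]
    simp

theorem U_eq {d : ℕ → ℕ} (hd : ∀ i, 1 ≤ i → 1 ≤ d i) (n k : ℕ) :
    U d n k = headLetter n :: (wpow (stdWord d (n + 1)) k ++ stdWord d n).dropLast := by
  induction k with
  | zero => simp [U, singWord_eq]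
  | succ k ih =>
    have h : U d n (k + 1) = (singWord d n ++ adjWord d n) ++ U d n k := by
      simp [U, wpow_succ]
    rw [h, ih, singWord_append_adjWord hd, List.dropLast_append_of_ne_nil (stdWord_ne_nil d n),
      List.dropLast_append_of_ne_nil (stdWord_ne_nil d n), wpow_succ]
    conv_rhs => rw [List.append_assoc]; arg 2; arg 1; rw [stdWord_succ_eq d n]
    simp

theorem U_pred {d : ℕ → ℕ} (hd : ∀ i, 1 ≤ i → 1 ≤ d i) (n : ℕ) :
    U d n (d (n + 1) - 1) = adjWord d (n + 1) := by
  rw [U_eq hd, adjWord_succ]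

theorem U_self {d : ℕ → ℕ} (hd : ∀ i, 1 ≤ i → 1 ≤ d i) (n : ℕ) :
    U d n (d (n + 1)) = singWord d (n + 2) := by
  rw [U_eq hd, singWord_eq, headLetter_add_two]
  rfl

theorem U_zero (d : ℕ → ℕ) (n : ℕ) : U d n 0 = singWord d n := by simp [U]

theorem Ubar_zero (d : ℕ → ℕ) (n : ℕ) : Ubar d n 0 = adjWord d n := by simp [Ubar]

theorem U_succ (d : ℕ → ℕ) (n k : ℕ) :
    U d n (k + 1) = singWord d n ++ Ubar d n k ++ singWord d n := by
  rw [U, Ubar, wpow_append_comm, wpow_succ']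
  simp

theorem Ubar_succ (d : ℕ → ℕ) (n k : ℕ) :
    Ubar d n (k + 1) = adjWord d n ++ U d n k ++ adjWord d n := by
  rw [U, Ubar, wpow_append_comm, wpow_succ']
  simp

theorem reverse_U {d : ℕ → ℕ} {n : ℕ} (hs : (singWord d n).reverse = singWord d n)
    (ha : (adjWord d n).reverse = adjWord d n) (k : ℕ) : (U d n k).reverse = U d n k := by
  rw [U, List.reverse_append, reverse_wpow, List.reverse_append, hs, ha, wpow_append_comm]

/-- `U_self` raises the index of `singWord` by two, so the induction carries two consecutive
singular words. -/
theorem reverse_adjWord_singWord {d : ℕ → ℕ} (hd : ∀ i, 1 ≤ i → 1 ≤ d i) (n : ℕ) :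
    (adjWord d n).reverse = adjWord d n ∧ (singWord d n).reverse = singWord d n ∧
      (singWord d (n + 1)).reverse = singWord d (n + 1) := by
  induction n with
  | zero => simp [adjWord, singWord, stdWord]
  | succ n ih =>
    obtain ⟨ha, hs, hs'⟩ := ih
    refine ⟨?_, hs', ?_⟩
    · rw [← U_pred hd, reverse_U hs ha]
    · rw [← U_self hd, reverse_U hs ha]

theorem U_prefix_U (d : ℕ → ℕ) (n : ℕ) {k l : ℕ} (h : k ≤ l) : U d n k <+: U d n l := by
  induction l, h using Nat.le_induction with
  | base => exact List.prefix_rfl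
  | succ l _ ih =>
    refine ih.trans ⟨adjWord d n ++ singWord d n, ?_⟩
    rw [U, U, wpow_succ']
    simp [List.append_assoc]

theorem isFactor_singWord {α : ℝ} (hirr : Irrational α) (h0 : 0 < α) (h1 : α < 1) {d : ℕ → ℕ}
    (hd : IsDirective α d) (n : ℕ) : IsFactor (singWord d n) (charWord α) := by
  have h : IsFactor (stdWord d (n + 2)) (charWord α) :=
    (isFactor_iff _ _).2 ⟨0, occAt_stdWord hirr h0 h1 hd (n + 1)⟩
  refine h.of_infix ?_
  obtain ⟨e, he⟩ := Nat.exists_eq_add_of_le' (hd.1 (n + 1) (by omega))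
  have h2 := stdWord_eq d n
  -- The singular word straddles the last junction: the final letter of `stdWord d (n + 1)`, then
  -- `stdWord d n` without its last letter.
  refine ⟨wpow (stdWord d (n + 1)) e ++ (stdWord d (n + 1)).dropLast,
    [if Even n then Letter.b else Letter.a], ?_⟩
  simp only [stdWord]
  rw [he, wpow_succ', singWord_eq]
  conv_rhs => rw [h2]; arg 1; arg 2; rw [stdWord_succ_eq d n]
  simp

theorem isFactor_U {α : ℝ} (hirr : Irrational α) (h0 : 0 < α) (h1 : α < 1) {d : ℕ → ℕ}
    (hd : IsDirective α d) {n k : ℕ} (hk : k ≤ d (n + 1)) : IsFactor (U d n k) (charWord α) := by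
  have h := isFactor_singWord hirr h0 h1 hd (n + 2)
  rw [← U_self hd.1] at h
  exact h.of_infix (U_prefix_U d n hk).isInfix

theorem isFactor_Ubar {α : ℝ} (hirr : Irrational α) (h0 : 0 < α) (h1 : α < 1) {d : ℕ → ℕ}
    (hd : IsDirective α d) {n k : ℕ} (hk : k + 1 ≤ d (n + 1)) :
    IsFactor (Ubar d n k) (charWord α) := by
  refine (isFactor_U hirr h0 h1 hd hk).of_infix ⟨singWord d n, singWord d n, ?_⟩
  rw [U_succ]

/-! ### Palindromic factors -/

/-- `u = v p ṽ` for some word `v`. -/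
def IsCentral (p u : Word) : Prop := ∃ v : Word, u = v ++ p ++ v.reverse

theorem IsCentral.length_le {p u : Word} (h : IsCentral p u) : p.length ≤ u.length := by
  obtain ⟨v, rfl⟩ := h
  simp
  omega

theorem isCentral_of_suffix {p v w : Word} (h : w <:+ v) :
    IsCentral (w ++ p ++ w.reverse) (v ++ p ++ v.reverse) := by
  obtain ⟨t, rfl⟩ := h
  exact ⟨t, by simp⟩

theorem infix_of_suffix {p v w : Word} (h : v <:+ w) :
    v ++ p ++ v.reverse <:+: w ++ p ++ w.reverse := by
  obtain ⟨t, ht⟩ := isCentral_of_suffix (p := p) h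
  exact ⟨t, t.reverse, ht.symm⟩

theorem isCentral_of_palindrome {u : Word} (hu : u.reverse = u) :
    IsCentral [] u ∨ IsCentral [Letter.a] u ∨ IsCentral [Letter.b] u := by
  have hp : u.Palindrome := List.Palindrome.of_reverse_eq hu
  induction hp with
  | nil => exact Or.inl ⟨[], rfl⟩
  | singleton x =>
    right
    cases x
    · exact Or.inl ⟨[], rfl⟩
    · exact Or.inr ⟨[], rfl⟩
  | @cons_concat x l hl ih =>
    have step : ∀ p, IsCentral p l → IsCentral p (x :: (l ++ [x])) := by
      rintro p ⟨v, rfl⟩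
      exact ⟨x :: v, by simp⟩
    exact (ih hl.reverse_eq).imp (step _) (Or.imp (step _) (step _))

/-- The `n`-th level of the list of palindromic factors. -/
def Listed (d : ℕ → ℕ) (u : Word) (n : ℕ) : Prop :=
  (∃ (k : ℕ) (v : Word), IsProperSuffix v (adjWord d n) ∧ k + 2 ≤ d (n + 1) ∧
    u = v ++ U d n k ++ v.reverse) ∨
  (∃ (k : ℕ) (v : Word), IsProperSuffix v (singWord d n) ∧ k + 1 ≤ d (n + 1) ∧
    u = v ++ Ubar d n k ++ v.reverse)

theorem Listed.isFactor {α : ℝ} (hirr : Irrational α) (h0 : 0 < α) (h1 : α < 1) {d : ℕ → ℕ}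
    (hd : IsDirective α d) {u : Word} {n : ℕ} (h : Listed d u n) : IsFactor u (charWord α) := by
  obtain ⟨ha, hs, -⟩ := reverse_adjWord_singWord hd.1 n
  obtain ⟨k, v, ⟨hv, -⟩, hk, rfl⟩ | ⟨k, v, ⟨hv, -⟩, hk, rfl⟩ := h
  · refine (isFactor_Ubar hirr h0 h1 hd (k := k + 1) (by omega)).of_infix ?_
    have := infix_of_suffix (p := U d n k) hv
    rwa [ha, ← Ubar_succ] at this
  · refine (isFactor_U hirr h0 h1 hd hk).of_infix ?_
    have := infix_of_suffix (p := Ubar d n k) hv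
    rwa [hs, ← U_succ] at this

/-- One level of the climb, by induction on the number `e` of links left. At the top, `U` is already
v_{n-1} and is handed on to the next level, which is why (1) stops one `k` earlier than (2). -/
theorem listed_or_isCentral_top {α : ℝ} (hirr : Irrational α) (h0 : 0 < α) (h1 : α < 1)
    {d : ℕ → ℕ} (hd : IsDirective α d) {u : Word} (hu : IsFactor u (charWord α)) (n : ℕ)
    {k : ℕ} (hk : k + 1 ≤ d (n + 1)) (h : IsCentral (U d n k) u ∨ IsCentral (Ubar d n k) u) :
    Listed d u n ∨ IsCentral (adjWord d (n + 1)) u ∨ IsCentral (singWord d (n + 2)) u := by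
  obtain ⟨ha, hs, -⟩ := reverse_adjWord_singWord hd.1 n
  obtain ⟨e, he⟩ := Nat.exists_eq_add_of_le hk
  induction e generalizing k with
  | zero =>
    rcases h with h | ⟨v, rfl⟩
    · rw [← U_pred hd.1, he]
      exact Or.inr (Or.inl h)
    · have hU := isFactor_U hirr h0 h1 hd hk
      have hcmp := suffix_or_suffix_of_isFactor h0 h1 (w := singWord d n) hu
        (by rwa [hs, ← U_succ])
      by_cases hw : singWord d n <:+ v
      · have := isCentral_of_suffix (p := Ubar d n k) hw
        rw [hs, ← U_succ] at this
        rw [← U_self hd.1, he]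
        exact Or.inr (Or.inr this)
      · refine Or.inl (Or.inr ⟨k, v, ⟨hcmp.resolve_right hw, ?_⟩, hk, rfl⟩)
        rintro rfl
        exact hw List.suffix_rfl
  | succ e ih =>
    refine or_iff_not_imp_left.2 fun hl => (ih (k := k + 1) (by omega) ?_ (by omega)).resolve_left hl
    rcases h with ⟨v, rfl⟩ | ⟨v, rfl⟩
    · have hU := isFactor_Ubar hirr h0 h1 hd (n := n) (k := k + 1) (by omega)
      have hcmp := suffix_or_suffix_of_isFactor h0 h1 (w := adjWord d n) hu
        (by rwa [ha, ← Ubar_succ])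
      by_cases hw : adjWord d n <:+ v
      · have := isCentral_of_suffix (p := U d n k) hw
        rw [ha, ← Ubar_succ] at this
        exact Or.inr this
      · refine absurd (Or.inl ⟨k, v, ⟨hcmp.resolve_right hw, ?_⟩, by omega, rfl⟩) hl
        rintro rfl
        exact hw List.suffix_rfl
    · have hU := isFactor_U hirr h0 h1 hd hk
      have hcmp := suffix_or_suffix_of_isFactor h0 h1 (w := singWord d n) hu
        (by rwa [hs, ← U_succ])
      by_cases hw : singWord d n <:+ v
      · have := isCentral_of_suffix (p := Ubar d n k) hw
        rw [hs, ← U_succ] at this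
        exact Or.inl this
      · refine absurd (Or.inr ⟨k, v, ⟨hcmp.resolve_right hw, ?_⟩, hk, rfl⟩) hl
        rintro rfl
        exact hw List.suffix_rfl

theorem listed_or_isCentral {α : ℝ} (hirr : Irrational α) (h0 : 0 < α) (h1 : α < 1)
    {d : ℕ → ℕ} (hd : IsDirective α d) {u : Word} (hpal : u.reverse = u)
    (hu : IsFactor u (charWord α)) (n : ℕ) :
    (∃ m, Listed d u m) ∨ IsCentral (adjWord d n) u ∨ IsCentral (singWord d n) u ∨
      IsCentral (singWord d (n + 1)) u := by
  induction n with
  | zero =>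
    right
    simpa [adjWord, singWord, stdWord] using isCentral_of_palindrome hpal
  | succ n ih =>
    have hk : 0 + 1 ≤ d (n + 1) := hd.1 _ (by omega)
    have top := listed_or_isCentral_top hirr h0 h1 hd hu n hk
    rw [U_zero, Ubar_zero] at top
    have hl : Listed d u n → ∃ m, Listed d u m := fun h => ⟨n, h⟩
    tauto

theorem le_length_singWord {d : ℕ → ℕ} (hd : ∀ i, 1 ≤ i → 1 ≤ d i) (n : ℕ) :
    n ≤ (singWord d n).length := by
  have h1 := le_length_stdWord hd n
  rw [singWord_eq]
  simp
  omega

theorem le_length_adjWord {d : ℕ → ℕ} (hd : ∀ i, 1 ≤ i → 1 ≤ d i) (n : ℕ) :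
    n ≤ (adjWord d (n + 1)).length := by
  rw [← U_pred hd, U, List.length_append]
  have := le_length_singWord hd n
  omega

end Sturmian

theorem mainTheorem8 (α : ℝ) (hirr : Irrational α) (h0 : 0 < α) (h1 : α < 1)
    (d : ℕ → ℕ) (hd : Sturmian.IsDirective α d)
    (u : Sturmian.Word) (hpal : u.reverse = u) (hlen : 2 ≤ u.length) :
    Sturmian.IsFactor u (Sturmian.charWord α) ↔
      ∃ n : ℕ,
        (∃ (k : ℕ) (v : Sturmian.Word),
          Sturmian.IsProperSuffix v (Sturmian.adjWord d n) ∧ k + 2 ≤ d (n + 1) ∧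
            u = v ++ Sturmian.U d n k ++ v.reverse) ∨
        (∃ (k : ℕ) (v : Sturmian.Word),
          Sturmian.IsProperSuffix v (Sturmian.singWord d n) ∧ k + 1 ≤ d (n + 1) ∧
            u = v ++ Sturmian.Ubar d n k ++ v.reverse) := by
  constructor
  · intro hu
    -- At level |u| + 2 all three centres are longer than `u`; the bound for `adjWord` costs one
    -- index.
    rcases Sturmian.listed_or_isCentral hirr h0 h1 hd hpal hu (u.length + 1 + 1) with h | h | h | h
    · exact h
    · have h2 := h.length_le
      have h3 := Sturmian.le_length_adjWord hd.1 (u.length + 1)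
      omega
    · have h2 := h.length_le
      have h3 := Sturmian.le_length_singWord hd.1 (u.length + 1 + 1)
      omega
    · have h2 := h.length_le
      have h3 := Sturmian.le_length_singWord hd.1 (u.length + 1 + 1 + 1)
      omega
  · rintro ⟨n, h⟩
    exact Sturmian.Listed.isFactor hirr h0 h1 hd h
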